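/- **Setting.** Let $(\mathcal A,\varphi)$ be a $W^*$-probability space: $\mathcal A$ is a von Neumann algebra and $\varphi$ is a faithful normal tracial state on $\mathcal A$. Let $L(a)$ and $R(a)$ be the operators of left and right multiplication by $a\in\mathcal A$ on $L^2(\mathcal A,\varphi)$, and let $B(L^2(\mathcal A,\varphi))$ carry the state $T\mapsto\langle Te,e\rangle$, where $e$ is the vector given by the unit of $\mathcal A$. Let $\kappa_n$ denote the free cumulants of $(\mathcal A,\varphi)$ and $\kappa_\chi$ the bi-free cumulants of $B(L^2(\mathcal A,\varphi))$ with this state. For $\chi:\{1,\dots,n\}\to\{l,r\}$ let $s_\chi(1),\dots,s_\chi(n)$ list the elements of $\chi^{-1}(l)$ in increasing order and then those of $\chi^{-1}(r)$ in decreasing order. A pair $(X,Y)$ of operators is *R-diagonal* if $\kappa_\chi(Z_1,\dots,Z_n)=0$ for all $n$, all $\chi$ and all words $Z_1,\dots,Z_n$ with $Z_i\in\{X,X^*\}$ when $\chi(i)=l$ and $Z_i\in\{Y,Y^*\}$ when $\chi(i)=r$, unless $n$ is even and starred and unstarred letters alternate in $Z_{s_\chi(1)},\dots,Z_{s_\chi(n)}$.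 The *$*$-distribution* of $(X,Y)$ is the family of expectations of all words in $X,X^*,Y,Y^*$. For $x,y\in\mathcal A$, $n\ge1$ and $k_1,k_2\ge0$ with $k_1+k_2=2n$, consider the two words of length $2n$ in which starred and unstarred letters alternate, whose first $k_1$ letters are from $\{x,x^*\}$ and whose last $k_2$ letters are from $\{y,y^*\}$. Multiplying consecutive letters in pairs gives the $n$-tuple $(xx^*,\dots,yy^*)$ if the word begins with an unstarred letter, and $(x^*x,\dots,y^*y)$ if it begins with a starred one; if $k_1$ is odd, one entry is $xy^*$, respectively $x^*y$. The free cumulants $\kappa_n(xx^*,\dots,yy^*)$ and $\kappa_n(x^*x,\dots,y^*y)$ of all these tuples (over all $n,k_1,k_2$) are called the mixed cumulants of $(x,y)$. **Proposition 3.1.** (a) If $(L(x),R(y))$ is R-diagonal, then its $*$-distribution is determined by the mixed cumulants of $(x,y)$: there is a map $F$, independent of $(\mathcal A,\varphi)$, $x$ and $y$, such that for every $W^*$-probability space $(\mathcal A,\varphi)$ and all $x,y\in\mathcal A$ with $(L(x),R(y))$ R-diagonal, the $*$-distribution of $(L(x),R(y))$ is the value of $F$ at the family of mixed cumulants of $(x,y)$.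 (b) Let $x_1,y_1,x_2,y_2\in\mathcal A$ be such that $(L(x_1),R(y_1))$ and $(L(x_2),R(y_2))$ are R-diagonal. If $$\kappa_n(x_1x_1^*,\dots,y_1y_1^*)=\kappa_n(x_2x_2^*,\dots,y_2y_2^*),\qquad \kappa_n(x_1^*x_1,\dots,y_1^*y_1)=\kappa_n(x_2^*x_2,\dots,y_2^*y_2)$$ for all $n\ge1$ and all $k_1,k_2\ge0$ with $k_1+k_2=2n$, then $(L(x_1),R(y_1))$ and $(L(x_2),R(y_2))$ are identically $*$-distributed. -/

import Mathlib

open scoped ComplexOrder InnerProductSpace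

universe u

namespace BiFree

/-! ### Cumulants over a noncommutative probability space -/

section Cumulants

/-- A partition of a finite set `S` is non-crossing for the order `prec` if there are no two
distinct blocks `V`, `W` with `a, c ∈ V`, `b, d ∈ W` and `a ≺ b ≺ c ≺ d`. -/
def IsNonCrossing {ι : Type*} [DecidableEq ι] (prec : ι → ι → Prop) {S : Finset ι}
    (π : Finpartition S) : Prop :=
  ∀ V ∈ π.parts, ∀ W ∈ π.parts, V ≠ W →
    ∀ a ∈ V, ∀ b ∈ W, ∀ c ∈ V, ∀ d ∈ W, ¬ (prec a b ∧ prec b c ∧ prec c d)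

open Classical in
/-- The cumulants attached to a family of moments `m` (one moment for each finite set of indices)
and to the partitions that are non-crossing for the order `prec`. They are determined by the
moment-cumulant formula `m S = ∑ π, ∏ V ∈ π, cumulant V`, the sum being over all non-crossing
partitions `π` of the non-empty set `S`; here it is solved for the term of the one-block
partition `{S}`. -/
noncomputable def cumulant {ι : Type*} [DecidableEq ι] (prec : ι → ι → Prop)
    (m : Finset ι → ℂ) (S : Finset ι) : ℂ :=
  m S - ∑ π : {π : Finpartition S // IsNonCrossing prec π ∧ S ∉ π.parts},
    ∏ V : {V : Finset ι // V ∈ π.1.parts}, cumulant prec m V.1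
termination_by S.card
decreasing_by
  have h1 : V.1 ⊆ S := π.1.le V.2
  have h2 : V.1 ≠ S := fun h => π.2.2 (by have hV := V.2; rwa [h] at hV)
  exact Finset.card_lt_card (h1.ssubset_of_ne h2)

open Classical in
/-- The moment-cumulant formula. -/
theorem moment_eq_sum_cumulant {ι : Type*} [DecidableEq ι] (prec : ι → ι → Prop)
    (m : Finset ι → ℂ) (S : Finset ι) (hS : S.Nonempty) :
    m S = ∑ π : {π : Finpartition S // IsNonCrossing prec π},
      ∏ V ∈ π.1.parts, cumulant prec m V := by
  have hi : IsNonCrossing prec (Finpartition.indiscrete hS.ne_empty) := by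
    intro V hV W hW hne
    simp [Finpartition.indiscrete] at hV hW
    exact absurd (hV.trans hW.symm) hne
  have hone : ∀ π : Finpartition S, S ∈ π.parts → π = Finpartition.indiscrete hS.ne_empty := by
    intro π hπ
    apply Finpartition.ext
    ext V
    simp only [Finpartition.indiscrete, Finset.mem_singleton]
    constructor
    · intro hV
      by_contra hne
      have := π.disjoint hV hπ hne
      have h2 := π.nonempty_of_mem_parts hV
      obtain ⟨v, hv⟩ := h2
      exact Finset.disjoint_left.mp this hv (π.le hV hv)
    · rintro rfl; exact hπ
  have h1 : cumulant prec m S = m S - ∑ π : {π : Finpartition S // IsNonCrossing prec π ∧ S ∉ π.parts},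
      ∏ V ∈ π.1.parts, cumulant prec m V := by
    rw [cumulant]
    congr 1
    refine Finset.sum_congr rfl fun π _ => ?_
    exact Finset.prod_coe_sort π.1.parts (fun V => cumulant prec m V)
  rw [← Finset.add_sum_erase _ _ (Finset.mem_univ (⟨_, hi⟩ : {π : Finpartition S // IsNonCrossing prec π}))]
  have h2 : ∑ π ∈ Finset.univ.erase (⟨_, hi⟩ : {π : Finpartition S // IsNonCrossing prec π}), ∏ V ∈ π.1.parts, cumulant prec m V = ∑ π : {π : Finpartition S // IsNonCrossing prec π ∧ S ∉ π.parts},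
      ∏ V ∈ π.1.parts, cumulant prec m V := by
    refine Finset.sum_bij' (fun π h => ⟨π.1, π.2, fun hS' => ?_⟩) (fun π _ => ⟨π.1, π.2.1⟩) ?_ ?_ ?_ ?_ ?_
    · exact (Finset.mem_erase.mp h).1 (Subtype.ext (hone _ hS'))
    · simp
    · intro π _
      refine Finset.mem_erase.mpr ⟨fun h => π.2.2 ?_, Finset.mem_univ _⟩
      have := congrArg Subtype.val h
      simp only at this
      rw [this]; simp [Finpartition.indiscrete]
    all_goals simp
  rw [h2]
  simp only [Finpartition.indiscrete, Finset.prod_singleton]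
  rw [h1]; ring

variable {B : Type*} [Ring B] [Algebra ℂ B]

/-- The moment `φ (T i₁ ⋯ T iₖ)` of the subtuple of `T` with index set `S = {i₁ < ⋯ < iₖ}`. -/
noncomputable def tupleMoment (φ : B →ₗ[ℂ] ℂ) {n : ℕ} (T : Fin n → B) (S : Finset (Fin n)) : ℂ :=
  φ (((S.sort (· ≤ ·)).map T).prod)

/-- The free cumulant `κ_n (T 1, …, T n)`. -/
noncomputable def freeCumulant (φ : B →ₗ[ℂ] ℂ) {n : ℕ} (T : Fin n → B) : ℂ :=
  cumulant (· < ·) (tupleMoment φ T) Finset.univ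

/-- The two faces (left and right) of a pair. -/
inductive Face where
  | left
  | right
  deriving DecidableEq

/-- The order `≺_χ` on `{1, …, n}`: first the left indices in increasing order, then the right
indices in decreasing order. -/
def chiLT {n : ℕ} (χ : Fin n → Face) (i j : Fin n) : Prop :=
  match χ i, χ j with
  | .left, .left => i < j
  | .left, .right => True
  | .right, .left => False
  | .right, .right => j < i

/-- The sequence `s_χ(1), …, s_χ(n)`, which lists `{1, …, n}` in the order `≺_χ`. -/
def chiList {n : ℕ} (χ : Fin n → Face) : List (Fin n) :=
  (List.finRange n).filter (fun i => χ i = .left) ++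
    ((List.finRange n).filter (fun i => χ i = .right)).reverse

/-- `chiList χ` is increasing for `≺_χ` … -/
theorem chiList_pairwise {n : ℕ} (χ : Fin n → Face) : (chiList χ).Pairwise (chiLT χ) := by
  unfold chiList
  rw [List.pairwise_append]
  refine ⟨?_, ?_, ?_⟩
  · refine List.Pairwise.imp_of_mem ?_ ((List.pairwise_lt_finRange n).filter _)
    intro a b ha hb h
    simp at ha hb
    simp [chiLT, ha, hb, h]
  · rw [List.pairwise_reverse]
    refine List.Pairwise.imp_of_mem ?_ ((List.pairwise_lt_finRange n).filter _)
    intro a b ha hb h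
    simp at ha hb
    simp [chiLT, ha, hb, h]
  · intro a ha b hb
    simp at ha hb
    simp [chiLT, ha, hb]

/-- … and lists every index exactly once. -/
theorem chiList_perm {n : ℕ} (χ : Fin n → Face) : (chiList χ).Perm (List.finRange n) := by
  unfold chiList
  refine (List.Perm.append_left _ (List.reverse_perm _)).trans ?_
  have : (fun i => decide (χ i = .right)) = (fun i => !decide (χ i = .left)) := by
    funext i; cases h : χ i <;> simp
  rw [this]
  exact List.filter_append_perm _ _

/-- The bi-free cumulant `κ_χ (T 1, …, T n)`: bi-non-crossing partitions are those that are
non-crossing for `≺_χ`, while moments are taken in the natural order of the indices. -/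
noncomputable def biFreeCumulant (φ : B →ₗ[ℂ] ℂ) {n : ℕ} (χ : Fin n → Face) (T : Fin n → B) : ℂ :=
  cumulant (chiLT χ) (tupleMoment φ T) Finset.univ

variable [StarRing B]

/-- The letters of the two-faced family `((x, x*), (y, y*))`: `x` or `x*` on the left face, `y` or
`y*` on the right face; the Boolean says whether the letter is starred. -/
def letter (x y : B) : Face → Bool → B
  | .left, false => x
  | .left, true => star x
  | .right, false => y
  | .right, true => star y

/-- `(x, y)` is an R-diagonal pair in `(B, φ)`: the bi-free cumulants of `((x, x*), (y, y*))` of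
odd order vanish, and so do those of even order, unless starred and unstarred letters alternate
when the letters are listed in the order `≺_χ`. -/
def IsRDiagonal (φ : B →ₗ[ℂ] ℂ) (x y : B) : Prop :=
  ∀ (n : ℕ) (χ : Fin n → Face) (ω : Fin n → Bool),
    ¬ (Even n ∧ ((chiList χ).map ω).IsChain (· ≠ ·)) →
      biFreeCumulant φ χ (fun i => letter x y (χ i) (ω i)) = 0

/-- The `*`-moments of the pair `(x, y)` in `(B, φ)`, that is, the `*`-distribution of `(x, y)`
evaluated at all words in `X, X*, Y, Y*`. -/
def starMoment (φ : B →ₗ[ℂ] ℂ) (x y : B) (w : List (Face × Bool)) : ℂ :=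
  φ ((w.map fun p => letter x y p.1 p.2).prod)

/-- The pairs `(x₁, y₁)` and `(x₂, y₂)` are identically `*`-distributed. -/
def IdenticallyStarDistributed (φ : B →ₗ[ℂ] ℂ) (x₁ y₁ x₂ y₂ : B) : Prop :=
  ∀ w : List (Face × Bool), starMoment φ x₁ y₁ w = starMoment φ x₂ y₂ w

/-- The tuple of length `n` that is obtained from the word of length `2 n` in which starred and
unstarred letters alternate, whose first `k` letters are from `{x, x*}` and whose other letters are
from `{y, y*}`, by multiplying the letters in consecutive pairs. The word begins with an unstarred
letter if `ε = false`, which gives `(x x*, …, y y*)`, and with a starred letter if `ε = true`,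
which gives `(x* x, …, y* y)`. If `k` is odd, one entry is `x y*` or `x* y`. -/
def mixedTuple (x y : B) (n k : ℕ) (ε : Bool) (i : Fin n) : B :=
  letter x y (if 2 * (i : ℕ) < k then .left else .right) ε *
    letter x y (if 2 * (i : ℕ) + 1 < k then .left else .right) (!ε)

/-- The free cumulant of order `n` of `mixedTuple x y n k ε`. -/
noncomputable def mixedCumulant (φ : B →ₗ[ℂ] ℂ) (x y : B) (n k : ℕ) (ε : Bool) : ℂ :=
  freeCumulant φ (mixedTuple x y n k ε)

end Cumulants

/-! ### The standard form of a tracial W*-probability space -/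

section StandardForm

variable {A : Type*} [CStarAlgebra A] [PartialOrder A] [StarOrderedRing A]

/-- `φ` is a faithful normal tracial state. Normality: `φ` preserves suprema of increasing nets. -/
structure IsFaithfulNormalTracialState (φ : A →ₚ[ℂ] ℂ) : Prop where
  map_one : φ 1 = 1
  tracial : ∀ a b : A, φ (a * b) = φ (b * a)
  faithful : ∀ a : A, φ (star a * a) = 0 → a = 0
  normal : ScottContinuous φ

/-- `L(a)` on `L²(A, φ)`: the extension of `b ↦ a b` to the completion of `A` with respect to the
inner product `⟪b, c⟫ = φ (b* c)`. -/
noncomputable def leftMul (φ : A →ₚ[ℂ] ℂ) (a : A) : φ.GNS →L[ℂ] φ.GNS :=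
  φ.gnsStarAlgHom a

/-- Right multiplication `b ↦ b a` on `A` with the inner product `⟪b, c⟫ = φ (b* c)`; it is
bounded since `φ` is a trace. -/
noncomputable def rightMulPre (φ : A →ₚ[ℂ] ℂ) (hφ : ∀ a b : A, φ (a * b) = φ (b * a)) (a : A) :
    φ.PreGNS →L[ℂ] φ.PreGNS :=
  LinearMap.mkContinuous
    (φ.toPreGNS.toLinearMap ∘ₗ LinearMap.mulRight ℂ a ∘ₗ φ.ofPreGNS.toLinearMap) ‖a‖ fun x ↦ by
      have key : φ (star (φ.ofPreGNS x * a) * (φ.ofPreGNS x * a)) ≤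
          (‖a‖ ^ 2 : ℝ) • φ (star (φ.ofPreGNS x) * φ.ofPreGNS x) := by
        set b := φ.ofPreGNS x
        have h : b * (a * star a) * star b ≤ ‖a * star a‖ • (b * star b) :=
          CStarAlgebra.star_right_conjugate_le_norm_smul
        rw [CStarRing.norm_self_mul_star, ← sq] at h
        calc φ (star (b * a) * (b * a)) = φ (b * (a * star a) * star b) := by
              rw [hφ, star_mul]; simp only [mul_assoc]
          _ ≤ φ (‖a‖ ^ 2 • (b * star b)) := OrderHomClass.mono φ h
          _ = (‖a‖ ^ 2 : ℝ) • φ (star b * b) := by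
              rw [hφ (star b) b, ← Complex.coe_smul, map_smul, Complex.coe_smul]
      rw [← sq_le_sq₀ (by positivity) (by positivity), mul_pow,
        ← RCLike.ofReal_le_ofReal (K := ℂ), RCLike.ofReal_pow, RCLike.ofReal_eq_complex_ofReal,
        PositiveLinearMap.preGNS_norm_sq]
      simpa [PositiveLinearMap.preGNS_norm_sq, Complex.real_smul] using key

/-- `R(a)` on `L²(A, φ)`: the extension of `b ↦ b a` to the completion. -/
noncomputable def rightMul (φ : A →ₚ[ℂ] ℂ) (hφ : ∀ a b : A, φ (a * b) = φ (b * a)) (a : A) :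
    φ.GNS →L[ℂ] φ.GNS :=
  (rightMulPre φ hφ a).completion

/-- The vector `e` of `L²(A, φ)` given by the unit of `A`. -/
noncomputable def unitVector (φ : A →ₚ[ℂ] ℂ) : φ.GNS :=
  ((φ.toPreGNS 1 : φ.PreGNS) : φ.GNS)

/-- The functional `T ↦ ⟨T e, e⟩` on `B(L²(A, φ))` (inner product linear in the argument `T e`). -/
noncomputable def vectorState (φ : A →ₚ[ℂ] ℂ) : (φ.GNS →L[ℂ] φ.GNS) →ₗ[ℂ] ℂ where
  toFun T := ⟪unitVector φ, T (unitVector φ)⟫_ℂ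
  map_add' S T := by simp [inner_add_right]
  map_smul' c T := by simp [inner_smul_right]

end StandardForm

end BiFree

/-!
The cumulants of two tuples whose proper subtuples have the same cumulants agree if and only if the
moments of the two tuples agree. As the cumulants of an R-diagonal pair vanish unless the stars
alternate in the order `≺_χ`, it follows by induction on the length that the `*`-distribution of
such a pair is determined by the moments of its alternating words. Now `L(x)` and `R(y)` act on the
unit vector by multiplication from the left and from the right, so that the moment of a word in
`L(x)` and `R(y)` is the value of `φ` at the same letters in `x` and `y`, listed in the order `≺_χ`.
For an alternating word this is `φ` of the product of one of the tuples `(x x*, …, y y*)` or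
`(x* x, …, y* y)`, and since subtuples of such tuples are again of this form, the mixed cumulants
determine it.
-/

namespace BiFree

section Transport

variable {ι κ : Type*} [DecidableEq ι] [DecidableEq κ]

/-- The image of a partition of `S` under an embedding, as a partition of `S.map f`. -/
def mapPartition (f : ι ↪ κ) {S : Finset ι} (π : Finpartition S) : Finpartition (S.map f) :=
  Finpartition.ofExistsUnique (π.parts.map (Finset.mapEmbedding f).toEmbedding)
    (by simpa using fun V hV => π.le hV)
    (Finset.forall_mem_map.mpr fun a ha => by
      simpa [ExistsUnique, and_assoc] using π.existsUnique_mem ha)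
    (by simp)

theorem parts_mapPartition (f : ι ↪ κ) {S : Finset ι} (π : Finpartition S) :
    (mapPartition f π).parts = π.parts.map (Finset.mapEmbedding f).toEmbedding :=
  rfl

theorem mapPartition_bijective (f : ι ↪ κ) (S : Finset ι) :
    Function.Bijective (mapPartition f (S := S)) := by
  refine ⟨fun π ρ h => Finpartition.ext (Finset.map_injective _ (congrArg Finpartition.parts h)),
    fun ρ => ?_⟩
  have hsub : ρ.parts ⊆ S.powerset.map (Finset.mapEmbedding f).toEmbedding := fun W hW => by
    obtain ⟨V, hV, rfl⟩ := Finset.subset_map_iff.mp (ρ.subset hW)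
    simpa using hV
  obtain ⟨P, hP, hρ⟩ := Finset.subset_map_iff.mp hsub
  refine ⟨.ofExistsUnique P (fun V hV => Finset.mem_powerset.mp (hP hV)) (fun a ha => ?_) ?_,
    Finpartition.ext hρ.symm⟩
  · simpa [hρ, ExistsUnique, and_assoc] using ρ.existsUnique_mem (Finset.mem_map_of_mem f ha)
  · simpa [hρ] using ρ.empty_notMem_parts

theorem isNonCrossing_mapPartition_iff (f : ι ↪ κ) {r : ι → ι → Prop} {s : κ → κ → Prop}
    (hf : ∀ a b, r a b ↔ s (f a) (f b)) {S : Finset ι} (π : Finpartition S) :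
    IsNonCrossing s (mapPartition f π) ↔ IsNonCrossing r π := by
  simp [IsNonCrossing, parts_mapPartition, hf]

open Classical in
theorem cumulant_eq_sub_sum (r : ι → ι → Prop) (m : Finset ι → ℂ) (S : Finset ι) :
    cumulant r m S = m S - ∑ π : {π : Finpartition S // IsNonCrossing r π ∧ S ∉ π.parts},
      ∏ V ∈ π.1.parts, cumulant r m V := by
  rw [cumulant]
  congr! 2 with π
  exact Finset.prod_coe_sort π.1.parts (cumulant r m)

theorem ssubset_of_mem_parts {S V : Finset ι} {π : Finpartition S} (hS : S ∉ π.parts)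
    (hV : V ∈ π.parts) : V ⊂ S :=
  (π.subset hV).ssubset_of_ne fun h => hS (h ▸ hV)

theorem cumulant_map (f : ι ↪ κ) {r : ι → ι → Prop} {s : κ → κ → Prop}
    (hf : ∀ a b, r a b ↔ s (f a) (f b)) {m : Finset ι → ℂ} {m' : Finset κ → ℂ}
    (hm : ∀ S, m S = m' (S.map f)) (S : Finset ι) :
    cumulant r m S = cumulant s m' (S.map f) := by
  classical
  induction S using Finset.strongInduction with
  | H S ih =>
    rw [cumulant_eq_sub_sum, cumulant_eq_sub_sum, hm]
    congr 1
    refine Fintype.sum_equiv ((Equiv.ofBijective _ (mapPartition_bijective f S)).subtypeEquiv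
      fun π => ?_) _ _ fun π => ?_
    · simp [isNonCrossing_mapPartition_iff f hf, parts_mapPartition]
    · simpa [parts_mapPartition] using
        Finset.prod_congr rfl fun V hV => ih V (ssubset_of_mem_parts π.2.2 hV)

theorem cumulant_eq_cumulant_iff {r : ι → ι → Prop} {m m' : Finset ι → ℂ} {S : Finset ι}
    (h : ∀ V, V.Nonempty → V ⊂ S → cumulant r m V = cumulant r m' V) :
    cumulant r m S = cumulant r m' S ↔ m S = m' S := by
  classical
  rw [cumulant_eq_sub_sum, cumulant_eq_sub_sum]
  have hsum : ∀ π : {π : Finpartition S // IsNonCrossing r π ∧ S ∉ π.parts},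
      ∏ V ∈ π.1.parts, cumulant r m V = ∏ V ∈ π.1.parts, cumulant r m' V := fun π =>
    Finset.prod_congr rfl fun V hV =>
      h V (π.1.nonempty_of_mem_parts hV) (ssubset_of_mem_parts π.2.2 hV)
  rw [Finset.sum_congr rfl fun π _ => hsum π, sub_left_inj]

end Transport

section Tuples

variable {B B₁ B₂ : Type*} [Ring B] [Algebra ℂ B] [Ring B₁] [Algebra ℂ B₁] [Ring B₂] [Algebra ℂ B₂]

theorem tupleMoment_comp (φ : B →ₗ[ℂ] ℂ) {n m : ℕ} (T : Fin n → B) (f : Fin m ↪o Fin n)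
    (S : Finset (Fin m)) : tupleMoment φ (T ∘ f) S = tupleMoment φ T (S.map f.toEmbedding) := by
  have h : S.sort.map f = (S.map f.toEmbedding).sort :=
    StrictMonoOn.map_finsetSort f.toEmbedding S (f.strictMono.strictMonoOn _)
  rw [tupleMoment, tupleMoment, ← h, List.map_map]

theorem tupleMoment_univ (φ : B →ₗ[ℂ] ℂ) {n : ℕ} (T : Fin n → B) :
    tupleMoment φ T Finset.univ = φ (List.ofFn T).prod := by
  rw [tupleMoment, Fin.sort_univ, List.ofFn_eq_map]

theorem chiLT_comp_iff {n m : ℕ} (χ : Fin n → Face) (f : Fin m ↪o Fin n) (i j : Fin m) :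
    chiLT (χ ∘ f) i j ↔ chiLT χ (f i) (f j) := by
  simp only [chiLT, Function.comp_apply, OrderEmbedding.lt_iff_lt]

theorem cumulant_tupleMoment (φ : B →ₗ[ℂ] ℂ) {n : ℕ} (χ : Fin n → Face) (T : Fin n → B)
    (V : Finset (Fin n)) :
    cumulant (chiLT χ) (tupleMoment φ T) V =
      biFreeCumulant φ (χ ∘ V.orderEmbOfFin rfl) (T ∘ V.orderEmbOfFin rfl) := by
  rw [biFreeCumulant, cumulant_map (V.orderEmbOfFin rfl).toEmbedding (chiLT_comp_iff χ _)
    (tupleMoment_comp φ T _), Finset.map_orderEmbOfFin_univ]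

theorem biFreeCumulant_eq_biFreeCumulant_iff {φ₁ : B₁ →ₗ[ℂ] ℂ} {φ₂ : B₂ →ₗ[ℂ] ℂ} {n : ℕ}
    {χ : Fin n → Face} {T₁ : Fin n → B₁} {T₂ : Fin n → B₂}
    (h : ∀ m, 0 < m → m < n → ∀ f : Fin m ↪o Fin n,
      biFreeCumulant φ₁ (χ ∘ f) (T₁ ∘ f) = biFreeCumulant φ₂ (χ ∘ f) (T₂ ∘ f)) :
    biFreeCumulant φ₁ χ T₁ = biFreeCumulant φ₂ χ T₂ ↔
      φ₁ (List.ofFn T₁).prod = φ₂ (List.ofFn T₂).prod := by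
  rw [← tupleMoment_univ, ← tupleMoment_univ]
  refine cumulant_eq_cumulant_iff fun V hV hVS => ?_
  rw [cumulant_tupleMoment, cumulant_tupleMoment]
  exact h _ hV.card_pos (by simpa using Finset.card_lt_card hVS) _

theorem freeCumulant_eq_biFreeCumulant_left (φ : B →ₗ[ℂ] ℂ) {n : ℕ} (T : Fin n → B) :
    freeCumulant φ T = biFreeCumulant φ (fun _ => .left) T :=
  rfl

end Tuples

section Words

/-- The letters of a word in a two-faced family in the order `≺_χ` of their positions: first the
left letters in their order, then the right letters in reverse order. -/
def twoSided (w : List (Face × Bool)) : List (Face × Bool) :=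
  w.filter (fun p => p.1 = .left) ++ (w.filter (fun p => p.1 = .right)).reverse

/-- A word is alternating if it has even length and starred and unstarred letters alternate along
the order `≺_χ`. -/
def IsAlternating (w : List (Face × Bool)) : Prop :=
  Even w.length ∧ ((twoSided w).map Prod.snd).IsChain (· ≠ ·)

/-- The alternating word of length `n` with `k` left letters followed by right letters, whose first
letter is starred if and only if `ε = true`. -/
def alternatingWord (n k : ℕ) (ε : Bool) : List (Face × Bool) :=
  (List.range n).map fun j => (if j < k then .left else .right, ε ^^ j.bodd)

theorem twoSided_ofFn {n : ℕ} (χ : Fin n → Face) (ω : Fin n → Bool) :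
    twoSided (List.ofFn fun i => (χ i, ω i)) = (chiList χ).map fun i => (χ i, ω i) := by
  simp [twoSided, chiList, List.ofFn_eq_map, List.filter_map, Function.comp_def]

theorem isAlternating_ofFn_iff {n : ℕ} {χ : Fin n → Face} {ω : Fin n → Bool} :
    IsAlternating (List.ofFn fun i => (χ i, ω i)) ↔
      Even n ∧ ((chiList χ).map ω).IsChain (· ≠ ·) := by
  simp [IsAlternating, twoSided_ofFn, Function.comp_def]

theorem length_twoSided (w : List (Face × Bool)) : (twoSided w).length = w.length := by
  have hright : (fun p : Face × Bool => decide (p.1 = .right)) = fun p => !decide (p.1 = .left) :=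
    funext fun ⟨c, _⟩ => by cases c <;> rfl
  rw [twoSided, List.length_append, List.length_reverse, hright,
    ← List.length_eq_length_filter_add]

theorem exists_map_fst_twoSided (w : List (Face × Bool)) :
    ∃ k l, (twoSided w).map Prod.fst = List.replicate k .left ++ List.replicate l .right := by
  refine ⟨(w.filter (fun p => p.1 = .left)).length, (w.filter (fun p => p.1 = .right)).length, ?_⟩
  rw [twoSided, List.map_append]
  congr 1 <;> exact List.eq_replicate_iff.mpr (by simp)

theorem exists_getElem_eq_xor_bodd {b : List Bool} (hb : b.IsChain (· ≠ ·)) :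
    ∃ ε, ∀ j, ∀ hj : j < b.length, b[j] = (ε ^^ j.bodd) := by
  rcases b with - | ⟨ε, b⟩
  · simp
  refine ⟨ε, fun j hj => ?_⟩
  induction j with
  | zero => simp
  | succ j ih =>
    have hne := List.isChain_iff_getElem.mp hb j hj
    rw [Bool.eq_not.mpr hne.symm, ih (by omega), Nat.bodd_succ, Bool.xor_not]

theorem IsAlternating.exists_twoSided_eq {w : List (Face × Bool)} (hw : IsAlternating w) :
    ∃ n k ε, twoSided w = alternatingWord (2 * n) k ε := by
  obtain ⟨⟨n, hn⟩, hchain⟩ := hw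
  obtain ⟨k, l, hface⟩ := exists_map_fst_twoSided w
  obtain ⟨ε, hε⟩ := exists_getElem_eq_xor_bodd hchain
  have hlength : (twoSided w).length = (alternatingWord (2 * n) k ε).length := by
    simp [alternatingWord, length_twoSided, hn, two_mul]
  refine ⟨n, k, ε, List.ext_getElem hlength fun j hj _ => Prod.ext ?_ ?_⟩
  · have hfst : ((twoSided w).map Prod.fst)[j]'(by simpa) = if j < k then .left else .right := by
      simp only [hface, List.getElem_append, List.getElem_replicate, List.length_replicate]
      split_ifs <;> rfl
    simpa [alternatingWord] using hfst
  · simpa [alternatingWord] using (List.getElem_map _).symm.trans (hε j (by simpa))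

end Words

section Mixed

theorem prod_map_range_two_mul {M : Type*} [Monoid M] (g : ℕ → M) (n : ℕ) :
    ((List.range (2 * n)).map g).prod =
      (List.ofFn fun i : Fin n => g (2 * i) * g (2 * i + 1)).prod := by
  induction n with
  | zero => simp
  | succ n ih =>
    rw [List.ofFn_succ', List.concat_eq_append, List.prod_append, mul_add]
    simp [List.range_succ, ih]

theorem exists_two_mul_add_lt_iff {m n : ℕ} (f : Fin m ↪o Fin n) (k : ℕ) :
    ∃ k' ≤ 2 * m, ∀ i : Fin m, ∀ j < 2, 2 * (i : ℕ) + j < k' ↔ 2 * (f i : ℕ) + j < k := by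
  classical
  let IsBound (t : ℕ) : Prop := ∀ i : Fin m, ∀ j < 2, t ≤ 2 * (i : ℕ) + j → k ≤ 2 * (f i : ℕ) + j
  have hm : IsBound (2 * m) := fun i j hj h => by omega
  refine ⟨Nat.find ⟨_, hm⟩, Nat.find_le hm, fun i j hj => ⟨fun h => ?_, fun h => ?_⟩⟩
  · have := Nat.find_min _ h
    simp only [IsBound, not_forall, not_le] at this
    obtain ⟨i', j', hj', hle, hlt⟩ := this
    rcases lt_trichotomy i i' with hi | rfl | hi
    · have : f i < f i' := f.strictMono hi
      omega
    · omega
    · omega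
  · by_contra! hle
    exact absurd (Nat.find_spec ⟨_, hm⟩ i j hj hle) (by omega)

variable {B : Type*} [Ring B] [StarRing B]

theorem mixedTuple_comp (x y : B) {m n k k' : ℕ} {f : Fin m → Fin n}
    (hf : ∀ i : Fin m, ∀ j < 2, 2 * (i : ℕ) + j < k' ↔ 2 * (f i : ℕ) + j < k) (ε : Bool) :
    mixedTuple x y n k ε ∘ f = mixedTuple x y m k' ε :=
  funext fun i => by
    have h₀ : 2 * (f i : ℕ) < k ↔ 2 * (i : ℕ) < k' := (hf i 0 two_pos).symm
    simp only [Function.comp_apply, mixedTuple, h₀, ← hf i 1 one_lt_two]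

variable [Algebra ℂ B]

theorem starMoment_ofFn (φ : B →ₗ[ℂ] ℂ) (x y : B) {n : ℕ} (χ : Fin n → Face) (ω : Fin n → Bool) :
    starMoment φ x y (List.ofFn fun i => (χ i, ω i)) =
      φ (List.ofFn fun i => letter x y (χ i) (ω i)).prod := by
  simp [starMoment, List.map_ofFn, Function.comp_def]

theorem starMoment_alternatingWord (φ : B →ₗ[ℂ] ℂ) (x y : B) (n k : ℕ) (ε : Bool) :
    starMoment φ x y (alternatingWord (2 * n) k ε) =
      φ (List.ofFn (mixedTuple x y n k ε)).prod := by
  rw [starMoment, alternatingWord, List.map_map, prod_map_range_two_mul]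
  refine congrArg (fun T => φ (List.ofFn T).prod) (funext fun i => ?_)
  simp [mixedTuple]

variable {B₁ B₂ : Type*} [Ring B₁] [Algebra ℂ B₁] [StarRing B₁] [Ring B₂] [Algebra ℂ B₂]
  [StarRing B₂] {φ₁ : B₁ →ₗ[ℂ] ℂ} {φ₂ : B₂ →ₗ[ℂ] ℂ} {x₁ y₁ : B₁} {x₂ y₂ : B₂}

theorem starMoment_alternatingWord_eq (h_one : φ₁ 1 = φ₂ 1)
    (hκ : ∀ n k : ℕ, 1 ≤ n → k ≤ 2 * n → ∀ ε,
      mixedCumulant φ₁ x₁ y₁ n k ε = mixedCumulant φ₂ x₂ y₂ n k ε) (n k : ℕ) (ε : Bool) :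
    starMoment φ₁ x₁ y₁ (alternatingWord (2 * n) k ε) =
      starMoment φ₂ x₂ y₂ (alternatingWord (2 * n) k ε) := by
  rw [starMoment_alternatingWord, starMoment_alternatingWord]
  have hsub : ∀ m, 0 < m → ∀ f : Fin m ↪o Fin n,
      biFreeCumulant φ₁ (fun _ => .left) (mixedTuple x₁ y₁ n k ε ∘ f) =
        biFreeCumulant φ₂ (fun _ => .left) (mixedTuple x₂ y₂ n k ε ∘ f) := fun m hm f => by
    obtain ⟨k', hk', hf⟩ := exists_two_mul_add_lt_iff f k
    rw [← freeCumulant_eq_biFreeCumulant_left, ← freeCumulant_eq_biFreeCumulant_left,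
      mixedTuple_comp x₁ y₁ hf, mixedTuple_comp x₂ y₂ hf]
    exact hκ m k' hm hk' ε
  rcases n.eq_zero_or_pos with rfl | hn
  · simpa using h_one
  · exact (biFreeCumulant_eq_biFreeCumulant_iff fun m hm _ f => hsub m hm f).mp
      (hsub n hn (OrderIso.refl _).toOrderEmbedding)

namespace IsRDiagonal

theorem biFreeCumulant_letter_eq (h₁ : IsRDiagonal φ₁ x₁ y₁) (h₂ : IsRDiagonal φ₂ x₂ y₂)
    (halt : ∀ w, IsAlternating w → starMoment φ₁ x₁ y₁ w = starMoment φ₂ x₂ y₂ w)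
    (n : ℕ) (χ : Fin n → Face) (ω : Fin n → Bool) :
    biFreeCumulant φ₁ χ (fun i => letter x₁ y₁ (χ i) (ω i)) =
      biFreeCumulant φ₂ χ (fun i => letter x₂ y₂ (χ i) (ω i)) := by
  induction n using Nat.strong_induction_on with
  | _ n ih =>
    by_cases hw : Even n ∧ ((chiList χ).map ω).IsChain (· ≠ ·)
    · refine (biFreeCumulant_eq_biFreeCumulant_iff fun m _ hm f => ih m hm (χ ∘ f) (ω ∘ f)).mpr ?_
      rw [← starMoment_ofFn, ← starMoment_ofFn]
      exact halt _ (isAlternating_ofFn_iff.mpr hw)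
    · rw [h₁ n χ ω hw, h₂ n χ ω hw]

theorem starMoment_eq (h₁ : IsRDiagonal φ₁ x₁ y₁) (h₂ : IsRDiagonal φ₂ x₂ y₂)
    (halt : ∀ w, IsAlternating w → starMoment φ₁ x₁ y₁ w = starMoment φ₂ x₂ y₂ w) :
    starMoment φ₁ x₁ y₁ = starMoment φ₂ x₂ y₂ := by
  funext w
  rw [← List.ofFn_get w, starMoment_ofFn, starMoment_ofFn]
  exact (biFreeCumulant_eq_biFreeCumulant_iff fun m _ _ f =>
    h₁.biFreeCumulant_letter_eq h₂ halt m _ _).mp (h₁.biFreeCumulant_letter_eq h₂ halt _ _ _)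

end IsRDiagonal

end Mixed

section StandardForm

variable {A : Type*} [CStarAlgebra A] [PartialOrder A] [StarOrderedRing A] (φ : A →ₚ[ℂ] ℂ)

theorem leftMul_coe (a b : A) : leftMul φ a (φ.toPreGNS b : φ.GNS) = φ.toPreGNS (a * b) :=
  φ.gnsNonUnitalStarAlgHom_apply_coe

theorem star_leftMul (a : A) : star (leftMul φ a) = leftMul φ (star a) :=
  (map_star φ.gnsStarAlgHom a).symm

variable (hφ : ∀ a b : A, φ (a * b) = φ (b * a))

theorem rightMul_coe (a b : A) : rightMul φ hφ a (φ.toPreGNS b : φ.GNS) = φ.toPreGNS (b * a) :=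
  ContinuousLinearMap.completion_apply_coe _ _

theorem star_rightMul (a : A) : star (rightMul φ hφ a) = rightMul φ hφ (star a) := by
  refine ((ContinuousLinearMap.eq_adjoint_iff _ _).mpr fun b c => ?_).symm
  induction b, c using UniformSpace.Completion.induction_on₂ with
  | hp => apply isClosed_eq <;> fun_prop
  | ih b c =>
    obtain ⟨b, rfl⟩ := φ.toPreGNS.surjective b
    obtain ⟨c, rfl⟩ := φ.toPreGNS.surjective c
    simp only [rightMul_coe, UniformSpace.Completion.inner_coe, φ.preGNS_inner_def,
      φ.ofPreGNS_toPreGNS, star_mul, star_star]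
    rw [mul_assoc, hφ, mul_assoc]

theorem letter_leftMul_rightMul_left (x y : A) (s : Bool) :
    letter (leftMul φ x) (rightMul φ hφ y) .left s = leftMul φ (letter x y .left s) := by
  cases s <;> simp [letter, star_leftMul]

theorem letter_leftMul_rightMul_right (x y : A) (s : Bool) :
    letter (leftMul φ x) (rightMul φ hφ y) .right s = rightMul φ hφ (letter x y .right s) := by
  cases s <;> simp [letter, star_rightMul]

theorem prod_letter_unitVector (x y : A) (w : List (Face × Bool)) :
    (w.map fun p => letter (leftMul φ x) (rightMul φ hφ y) p.1 p.2).prod (unitVector φ) =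
      φ.toPreGNS ((twoSided w).map fun p => letter x y p.1 p.2).prod := by
  induction w with
  | nil => simp [twoSided, unitVector]
  | cons p w ih =>
    obtain ⟨c, s⟩ := p
    rw [List.map_cons, List.prod_cons, mul_apply_eq_comp, ih]
    cases c
    · simp [twoSided, letter_leftMul_rightMul_left, leftMul_coe]
    · simp [twoSided, letter_leftMul_rightMul_right, rightMul_coe, mul_assoc]

theorem starMoment_vectorState (x y : A) (w : List (Face × Bool)) :
    starMoment (vectorState φ) (leftMul φ x) (rightMul φ hφ y) w =
      starMoment φ.toLinearMap x y (twoSided w) := by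
  change ⟪unitVector φ, _⟫_ℂ = _
  rw [prod_letter_unitVector, unitVector, UniformSpace.Completion.inner_coe, φ.preGNS_inner_def,
    φ.ofPreGNS_toPreGNS, φ.ofPreGNS_toPreGNS, star_one, one_mul]
  rfl

theorem starMoment_eq_of_mixedCumulant_eq {A₁ A₂ : Type*} [CStarAlgebra A₁] [PartialOrder A₁]
    [StarOrderedRing A₁] [CStarAlgebra A₂] [PartialOrder A₂] [StarOrderedRing A₂]
    {φ₁ : A₁ →ₚ[ℂ] ℂ} {φ₂ : A₂ →ₚ[ℂ] ℂ} {hφ₁ : ∀ a b : A₁, φ₁ (a * b) = φ₁ (b * a)}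
    {hφ₂ : ∀ a b : A₂, φ₂ (a * b) = φ₂ (b * a)} (h_one : φ₁ 1 = φ₂ 1) {x₁ y₁ : A₁} {x₂ y₂ : A₂}
    (h₁ : IsRDiagonal (vectorState φ₁) (leftMul φ₁ x₁) (rightMul φ₁ hφ₁ y₁))
    (h₂ : IsRDiagonal (vectorState φ₂) (leftMul φ₂ x₂) (rightMul φ₂ hφ₂ y₂))
    (hκ : ∀ n k : ℕ, 1 ≤ n → k ≤ 2 * n → ∀ ε,
      mixedCumulant φ₁.toLinearMap x₁ y₁ n k ε = mixedCumulant φ₂.toLinearMap x₂ y₂ n k ε) :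
    starMoment (vectorState φ₁) (leftMul φ₁ x₁) (rightMul φ₁ hφ₁ y₁) =
      starMoment (vectorState φ₂) (leftMul φ₂ x₂) (rightMul φ₂ hφ₂ y₂) := by
  refine h₁.starMoment_eq h₂ fun w hw => ?_
  obtain ⟨n, k, ε, hw⟩ := hw.exists_twoSided_eq
  rw [starMoment_vectorState, starMoment_vectorState, hw]
  exact starMoment_alternatingWord_eq h_one hκ n k ε

end StandardForm

section Determination

/-- An R-diagonal pair `(L(x), R(y))` bundled with its tracial C*-probability space, so that the
mixed cumulants and the `*`-distribution become functions on one type. -/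
structure RDiagonalPair where
  carrier : Type u
  [cStarAlgebra : CStarAlgebra carrier]
  [partialOrder : PartialOrder carrier]
  [starOrderedRing : StarOrderedRing carrier]
  state : carrier →ₚ[ℂ] ℂ
  tracial : ∀ a b : carrier, state (a * b) = state (b * a)
  map_one : state 1 = 1
  x : carrier
  y : carrier
  isRDiagonal : IsRDiagonal (vectorState state) (leftMul state x) (rightMul state tracial y)

namespace RDiagonalPair

attribute [instance] cStarAlgebra partialOrder starOrderedRing

theorem starMoment_factorsThrough :
    (fun P : RDiagonalPair.{u} =>
      starMoment (vectorState P.state) (leftMul P.state P.x)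
        (rightMul P.state P.tracial P.y)).FactorsThrough
      fun P => mixedCumulant P.state.toLinearMap P.x P.y := fun P Q hκ =>
  starMoment_eq_of_mixedCumulant_eq (P.map_one.trans Q.map_one.symm) P.isRDiagonal Q.isRDiagonal
    fun n k _ _ ε => congrFun (congrFun (congrFun hκ n) k) ε

end RDiagonalPair

end Determination

end BiFree

theorem proposition3p1_general :
    (∃ F : (ℕ → ℕ → Bool → ℂ) → (List (BiFree.Face × Bool) → ℂ),
      ∀ (A : Type u) [CStarAlgebra A] [PartialOrder A] [StarOrderedRing A]
        (φ : A →ₚ[ℂ] ℂ) (hφ : ∀ a b : A, φ (a * b) = φ (b * a)) (x y : A), φ 1 = 1 →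
        BiFree.IsRDiagonal (BiFree.vectorState φ) (BiFree.leftMul φ x) (BiFree.rightMul φ hφ y) →
          BiFree.starMoment (BiFree.vectorState φ)
              (BiFree.leftMul φ x) (BiFree.rightMul φ hφ y) =
            F (BiFree.mixedCumulant φ.toLinearMap x y)) ∧
    (∀ (A : Type u) [CStarAlgebra A] [PartialOrder A] [StarOrderedRing A]
      (φ : A →ₚ[ℂ] ℂ) (hφ : ∀ a b : A, φ (a * b) = φ (b * a)) (x₁ y₁ x₂ y₂ : A),
      BiFree.IsRDiagonal (BiFree.vectorState φ) (BiFree.leftMul φ x₁) (BiFree.rightMul φ hφ y₁) →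
      BiFree.IsRDiagonal (BiFree.vectorState φ) (BiFree.leftMul φ x₂) (BiFree.rightMul φ hφ y₂) →
      (∀ n k : ℕ, 1 ≤ n → k ≤ 2 * n →
        BiFree.mixedCumulant φ.toLinearMap x₁ y₁ n k false =
            BiFree.mixedCumulant φ.toLinearMap x₂ y₂ n k false ∧
          BiFree.mixedCumulant φ.toLinearMap x₁ y₁ n k true =
            BiFree.mixedCumulant φ.toLinearMap x₂ y₂ n k true) →
      BiFree.IdenticallyStarDistributed (BiFree.vectorState φ)
        (BiFree.leftMul φ x₁) (BiFree.rightMul φ hφ y₁)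
        (BiFree.leftMul φ x₂) (BiFree.rightMul φ hφ y₂)) := by
  constructor
  · obtain ⟨F, hF⟩ := (Function.factorsThrough_iff _).mp
      BiFree.RDiagonalPair.starMoment_factorsThrough.{u}
    exact ⟨F, fun A _ _ _ φ hφ x y h_one h => congrFun hF ⟨A, φ, hφ, h_one, x, y, h⟩⟩
  · intro A _ _ _ φ hφ x₁ y₁ x₂ y₂ h₁ h₂ hκ
    exact congrFun (BiFree.starMoment_eq_of_mixedCumulant_eq rfl h₁ h₂ fun n k hn hk =>
      Bool.forall_bool.mpr (hκ n k hn hk))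

theorem proposition3p1 :
    -- the `*`-distribution is determined by the mixed free cumulants
    (∃ F : (ℕ → ℕ → Bool → ℂ) → (List (BiFree.Face × Bool) → ℂ),
      ∀ (A : Type u) [CStarAlgebra A] [WStarAlgebra A] [PartialOrder A] [StarOrderedRing A]
        (φ : A →ₚ[ℂ] ℂ) (hφ : BiFree.IsFaithfulNormalTracialState φ) (x y : A),
        BiFree.IsRDiagonal (BiFree.vectorState φ)
            (BiFree.leftMul φ x) (BiFree.rightMul φ hφ.tracial y) →
          BiFree.starMoment (BiFree.vectorState φ)
              (BiFree.leftMul φ x) (BiFree.rightMul φ hφ.tracial y) =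
            F (BiFree.mixedCumulant φ.toLinearMap x y)) ∧
    -- R-diagonal pairs with the same mixed free cumulants are identically `*`-distributed
    (∀ (A : Type u) [CStarAlgebra A] [WStarAlgebra A] [PartialOrder A] [StarOrderedRing A]
      (φ : A →ₚ[ℂ] ℂ) (hφ : BiFree.IsFaithfulNormalTracialState φ) (x₁ y₁ x₂ y₂ : A),
      BiFree.IsRDiagonal (BiFree.vectorState φ)
          (BiFree.leftMul φ x₁) (BiFree.rightMul φ hφ.tracial y₁) →
      BiFree.IsRDiagonal (BiFree.vectorState φ)
          (BiFree.leftMul φ x₂) (BiFree.rightMul φ hφ.tracial y₂) →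
      (∀ n k : ℕ, 1 ≤ n → k ≤ 2 * n →
        BiFree.mixedCumulant φ.toLinearMap x₁ y₁ n k false =
            BiFree.mixedCumulant φ.toLinearMap x₂ y₂ n k false ∧
          BiFree.mixedCumulant φ.toLinearMap x₁ y₁ n k true =
            BiFree.mixedCumulant φ.toLinearMap x₂ y₂ n k true) →
      BiFree.IdenticallyStarDistributed (BiFree.vectorState φ)
        (BiFree.leftMul φ x₁) (BiFree.rightMul φ hφ.tracial y₁)
        (BiFree.leftMul φ x₂) (BiFree.rightMul φ hφ.tracial y₂)) := by
  obtain ⟨⟨F, hF⟩, hdistr⟩ := proposition3p1_general.{u}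
  exact ⟨⟨F, fun A _ _ _ _ φ hφ x y h => hF A φ hφ.tracial x y hφ.map_one h⟩,
    fun A _ _ _ _ φ hφ => hdistr A φ hφ.tracial⟩
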